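/- For integers $0\le K<n$, the random $K$-out graph $\mathbb{H}(n;K)$ on the nodes $1,\dots,n$ is defined as follows: the nodes $i=1,\dots,n$ independently choose sets $\Gamma_i$, where $\Gamma_i$ is uniformly distributed over the $K$-element subsets of $\{1,\dots,n\}\setminus\{i\}$, and two distinct nodes $i,j$ are adjacent if $j\in\Gamma_i$ or $i\in\Gamma_j$. For an integer $r\ge 1$, a set $S$ of nodes of a graph is called $r$-reachable if some node of $S$ has at least $r$ neighbours outside $S$; the graph is called $r$-robust if, for every two nonempty disjoint sets of nodes, at least one of the two is $r$-reachable. **Theorem.** 1. For every fixed integer $K\ge 2$ the maximum $$r^{\star}(K)=\max\Bigl\{r\in\{1,2,3,\dots\}:\ \lim_{n\to\infty}\mathbb{P}\bigl[\mathbb{H}(n;K)\text{ is } r\text{-robust}\bigr]=1\Bigr\}$$ exists, and $r^{\star}(K)\ge\lfloor K/2\rfloor$. 2. Let $r\ge 1$ be an integer and let $(K_n)$ be a sequence of integers with $2r\le K_n<n$ for all sufficiently large $n$ (for instance a constant sequence $K_n=K\ge 2r$). Then $$\lim_{n\to\infty}\mathbb{P}\bigl[\mathbb{H}(n;K_n)\text{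 is } r\text{-robust}\bigr]=1 .$$ -/

import Mathlib

open MeasureTheory ProbabilityTheory Filter Topology

namespace KOut

/-- A set `S` of nodes is `r`-reachable if some node of `S` has at least `r` neighbours
outside `S`. -/
def IsReachable {V : Type*} [Finite V] (G : SimpleGraph V) (r : ℕ) (S : Set V) : Prop :=
  ∃ i ∈ S, r ≤ (G.neighborSet i \ S).ncard

/-- A graph is `r`-robust if of any two nonempty disjoint sets of nodes at least one is
`r`-reachable. -/
def IsRobust {V : Type*} [Finite V] (G : SimpleGraph V) (r : ℕ) : Prop :=
  ∀ S S' : Set V, S.Nonempty → S'.Nonempty → Disjoint S S' →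
    IsReachable G r S ∨ IsReachable G r S'

/-- The possible selections of node `i`: the sets of `K` nodes that do not contain `i`. -/
def selections (n K : ℕ) (i : Fin n) : Set (Finset (Fin n)) :=
  {s | i ∉ s ∧ s.card = K}

/-- The (finite) space of sets of nodes, with the discrete σ-algebra. -/
instance instMeasurableSpaceFinsetFin (n : ℕ) : MeasurableSpace (Finset (Fin n)) := ⊤

/-- The joint law of the selections `Γ 1, …, Γ n`: they are independent, and `Γ i` is uniformly
distributed over the sets of `K` nodes other than `i`. (A probability measure when `K < n`.) -/
noncomputable def selectionLaw (n K : ℕ) : Measure (Fin n → Finset (Fin n)) :=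
  Measure.pi fun i => uniformOn (selections n K i)

/-- The graph of a family of selections: distinct nodes `i`, `j` are adjacent
if `j ∈ Γ i` or `i ∈ Γ j`. -/
def graph {n : ℕ} (Γ : Fin n → Finset (Fin n)) : SimpleGraph (Fin n) :=
  SimpleGraph.fromRel fun i j => j ∈ Γ i

/-- The probability that the random `K`-out graph on `n` nodes is `r`-robust. -/
noncomputable def probRobust (n K r : ℕ) : ENNReal :=
  selectionLaw n K {Γ | IsRobust (graph Γ) r}

/-- The positive integers `r` such that the random `K`-out graph on `n` nodes is `r`-robust with
probability tending to one as `n → ∞`. -/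
def robustLevels (K : ℕ) : Set ℕ :=
  {r | 1 ≤ r ∧ Tendsto (fun n => probRobust n K r) atTop (𝓝 1)}

/-- The largest element of `robustLevels K` (if there is one). -/
noncomputable def rStar (K : ℕ) : ℕ := sSup (robustLevels K)

end KOut

/-! If robustness fails, some nonempty `S` with `m = |S| ≤ n/2` is not `r`-reachable, so the limit
follows from a union bound over `S`. Adding selections only adds edges, so it suffices to treat `K =
2r`, where all constants depend on `r` alone.

Probabilities are proportions of selection families, estimated by Markov's inequality for product
weights: up to a factor `exp (2 * K ^ 2)`, the `K`-subsets behave like `K` independent uniform draws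
(`sum_prod_weight_le`). For `m < n/12` it is enough that each node of `S` makes fewer than `r`
selections outside `S`. For larger `m`, selections crossing the cut in both directions are counted:
there are at most `(r - 1) m` of them, plus a correction for pairs that select each other. The
number of such pairs has bounded mean, so outside one event of probability `O(1/n)` the correction
is at most `m/4`.

For the maximum, a degree count excludes every `r > 2K`, so the set of levels is bounded; it
contains `K / 2` by the limit theorem. -/

namespace KOut

/-! ### The selection law as a counting measure -/

/-- The families of selections, as a finite set. -/
def selectionFamilies (n K : ℕ) : Finset (Fin n → Finset (Fin n)) :=
  Fintype.piFinset fun i => Finset.powersetCard K (Finset.univ.erase i)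

lemma mem_selectionFamilies {n K : ℕ} {Γ : Fin n → Finset (Fin n)} :
    Γ ∈ selectionFamilies n K ↔ ∀ i, i ∉ Γ i ∧ (Γ i).card = K := by
  simp only [selectionFamilies, Fintype.mem_piFinset, Finset.mem_powersetCard,
    Finset.subset_erase, Finset.subset_univ, true_and]

lemma card_selectionFamilies (n K : ℕ) :
    (selectionFamilies n K).card = (n - 1).choose K ^ n := by
  simp [selectionFamilies, Fintype.card_piFinset]

lemma card_selectionFamilies_pos {n K : ℕ} (h : K < n) : 0 < (selectionFamilies n K).card := by
  rw [card_selectionFamilies]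
  exact pow_pos (Nat.choose_pos (by omega)) _

lemma selections_eq_coe (n K : ℕ) (i : Fin n) :
    selections n K i = ↑(Finset.powersetCard K (Finset.univ.erase i)) := by
  ext s
  simp [selections, Finset.mem_powersetCard, Finset.subset_erase]

lemma uniformOn_selections_singleton {n K : ℕ} (i : Fin n) (s : Finset (Fin n)) :
    uniformOn (selections n K i) {s} =
      if s ∈ Finset.powersetCard K (Finset.univ.erase i) then ((n - 1).choose K : ENNReal)⁻¹
      else 0 := by
  have : MeasurableSingletonClass (Finset (Fin n)) := ⟨fun _ => trivial⟩
  rw [uniformOn, cond_apply (by trivial), selections_eq_coe, Measure.count_apply_finset]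
  split_ifs with hs
  · rw [Set.inter_eq_right.2 (by simpa using hs), Measure.count_singleton]
    simp
  · rw [Set.inter_singleton_eq_empty.2 (by simpa using hs)]
    simp

lemma isProbabilityMeasure_uniformOn_selections {n K : ℕ} (h : K < n) (i : Fin n) :
    IsProbabilityMeasure (uniformOn (selections n K i)) := by
  have : MeasurableSingletonClass (Finset (Fin n)) := ⟨fun _ => trivial⟩
  refine isProbabilityMeasure_uniformOn (Set.toFinite _) ?_
  rw [selections_eq_coe, Finset.coe_nonempty, Finset.powersetCard_nonempty]
  simp
  omega

lemma isProbabilityMeasure_selectionLaw {n K : ℕ} (h : K < n) :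
    IsProbabilityMeasure (selectionLaw n K) := by
  have := isProbabilityMeasure_uniformOn_selections h
  unfold selectionLaw
  infer_instance

-- The law is a product of uniform laws, hence uniform on `selectionFamilies`; all later estimates
-- are therefore about cardinalities.
open Classical in
lemma selectionLaw_apply {n K : ℕ} (h : K < n) (E : Set (Fin n → Finset (Fin n))) :
    selectionLaw n K E =
      ENNReal.ofReal (((selectionFamilies n K).filter (· ∈ E)).card /
        (selectionFamilies n K).card) := by
  have : MeasurableSingletonClass (Finset (Fin n)) := ⟨fun _ => trivial⟩
  have := isProbabilityMeasure_uniformOn_selections h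
  have hsing : ∀ Γ, selectionLaw n K {Γ} =
      if Γ ∈ selectionFamilies n K then ((selectionFamilies n K).card : ENNReal)⁻¹ else 0 := by
    intro Γ
    rw [selectionLaw, Measure.pi_singleton]
    simp only [uniformOn_selections_singleton]
    split_ifs with hΓ
    · rw [selectionFamilies, Fintype.mem_piFinset] at hΓ
      simp only [hΓ, if_true, Finset.prod_const, Finset.card_univ, Fintype.card_fin,
        card_selectionFamilies, Nat.cast_pow, ENNReal.inv_pow]
    · rw [selectionFamilies, Fintype.mem_piFinset] at hΓ
      push Not at hΓ
      obtain ⟨i, hi⟩ := hΓ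
      exact Finset.prod_eq_zero (Finset.mem_univ i) (by rw [if_neg hi])
  have hE : E = ↑(Finset.univ.filter (· ∈ E)) := by ext; simp
  rw [ENNReal.ofReal_div_of_pos (by exact_mod_cast card_selectionFamilies_pos h),
    ENNReal.ofReal_natCast, ENNReal.ofReal_natCast]
  conv_lhs => rw [hE]
  rw [← sum_measure_singleton]
  simp only [hsing]
  rw [← Finset.sum_filter, Finset.sum_const, nsmul_eq_mul, ENNReal.div_eq_inv_mul, mul_comm]
  congr 3
  ext Γ
  simp [and_comm]

/-! ### Exponential moments -/

/-- `k!` times an elementary symmetric polynomial of degree `k` is at most the `k`-th power of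
the sum of its (nonnegative) variables. -/
lemma factorial_mul_sum_powersetCard_prod_le {α : Type*} [DecidableEq α] (w : α → ℝ)
    (hw : ∀ a, 0 ≤ w a) (s : Finset α) (k : ℕ) :
    (k.factorial : ℝ) * ∑ A ∈ s.powersetCard k, ∏ a ∈ A, w a ≤ (∑ a ∈ s, w a) ^ k := by
  induction s using Finset.induction_on generalizing k with
  | empty =>
    cases k with
    | zero => simp
    | succ k => simp [Finset.powersetCard_eq_empty.2 (show (∅ : Finset α).card < k + 1 by simp)]
  | insert b s hb ih =>
    cases k with
    | zero => simp
    | succ k =>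
      have hT : 0 ≤ ∑ a ∈ s, w a := Finset.sum_nonneg fun a _ => hw a
      have hsum : ∑ A ∈ (insert b s).powersetCard (k + 1), ∏ a ∈ A, w a =
          ∑ A ∈ s.powersetCard (k + 1), ∏ a ∈ A, w a
            + w b * ∑ A ∈ s.powersetCard k, ∏ a ∈ A, w a := by
        rw [Finset.powersetCard_succ_insert hb, Finset.sum_union, Finset.sum_image,
          Finset.mul_sum]
        · congr 1
          refine Finset.sum_congr rfl fun A hA => ?_
          rw [Finset.prod_insert fun h => hb ((Finset.mem_powersetCard.1 hA).1 h)]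
        · intro A hA B hB hAB
          have hA' : b ∉ A := fun h => hb ((Finset.mem_powersetCard.1 hA).1 h)
          have hB' : b ∉ B := fun h => hb ((Finset.mem_powersetCard.1 hB).1 h)
          rw [← Finset.erase_insert hA', hAB, Finset.erase_insert hB']
        · rw [Finset.disjoint_left]
          intro A hA hA'
          obtain ⟨B, -, rfl⟩ := Finset.mem_image.1 hA'
          exact hb ((Finset.mem_powersetCard.1 hA).1 (Finset.mem_insert_self _ _))
      rw [hsum, Finset.sum_insert hb, mul_add, Nat.factorial_succ]
      have h1 := ih (k + 1)
      have h2 := ih k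
      rw [Nat.factorial_succ] at h1
      set T := ∑ a ∈ s, w a
      -- The first two terms of the binomial expansion.
      have key : T ^ (k + 1) + (k + 1) * w b * T ^ k ≤ (w b + T) ^ (k + 1) := by
        clear h1 h2 ih hsum
        induction k with
        | zero => simp; linarith
        | succ k ih =>
          calc _ ≤ (w b + T) * (T ^ (k + 1) + (k + 1) * w b * T ^ k) := by
                have : 0 ≤ (k + 1) * w b * T ^ k * w b := by have := hw b; positivity
                push_cast
                linear_combination this
            _ ≤ _ := by
                rw [pow_succ' (w b + T) (k + 1)]
                exact mul_le_mul_of_nonneg_left ih (add_nonneg (hw b) hT)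
      have h3 := mul_le_mul_of_nonneg_left h2 (mul_nonneg (by positivity : (0:ℝ) ≤ k + 1) (hw b))
      push_cast at h1 ⊢
      nlinarith [h1, h3, key]

/-- The exponential moment bound behind all probability estimates. -/
lemma sum_prod_weight_le {n K : ℕ} (hn : 2 * K ≤ n) (hn0 : 0 < n) (w : Fin n → Fin n → ℝ)
    (hw : ∀ k a, 0 ≤ w k a) :
    ∑ Γ ∈ selectionFamilies n K, ∏ k, ∏ a ∈ Γ k, w k a ≤
      Real.exp (2 * K ^ 2) * (∏ k, ((∑ a, w k a) / n) ^ K) * (selectionFamilies n K).card := by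
  have hKn : (2 : ℝ) * K ≤ n := by exact_mod_cast hn
  have hnR : (0 : ℝ) < n := by exact_mod_cast hn0
  have hd : (0 : ℝ) < n - K := by
    have : (0 : ℝ) ≤ K := by positivity
    linarith
  rw [selectionFamilies, ← Finset.prod_univ_sum
    (fun k => Finset.powersetCard K (Finset.univ.erase k)) (fun k A => ∏ a ∈ A, w k a)]
  have hfac : ∀ k, ∑ A ∈ (Finset.univ.erase k).powersetCard K, ∏ a ∈ A, w k a ≤
      (n / (n - K) : ℝ) ^ K * ((∑ a, w k a) / n) ^ K * ((n - 1).choose K) := by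
    intro k
    have h1 := factorial_mul_sum_powersetCard_prod_le (w k) (hw k) (Finset.univ.erase k) K
    have h2 : (∑ a ∈ Finset.univ.erase k, w k a) ^ K ≤ (∑ a, w k a) ^ K := by
      refine pow_le_pow_left₀ (Finset.sum_nonneg fun a _ => hw k a) ?_ _
      exact Finset.sum_le_sum_of_subset_of_nonneg (Finset.subset_univ _) fun a _ _ => hw k a
    have h3 : ((n : ℝ) - K) ^ K ≤ K.factorial * (n - 1).choose K := by
      have := Nat.pow_sub_le_descFactorial (n - 1) K
      rw [Nat.descFactorial_eq_factorial_mul_choose, show n - 1 + 1 - K = n - K by omega] at this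
      have h := (Nat.cast_le (α := ℝ)).2 this
      rw [Nat.cast_pow, Nat.cast_sub (by omega)] at h
      exact_mod_cast h
    have hf : (0 : ℝ) < K.factorial := by positivity
    have hW : (0 : ℝ) ≤ (∑ a, w k a) ^ K := pow_nonneg (Finset.sum_nonneg fun a _ => hw k a) _
    rw [← mul_pow, div_mul_div_comm, mul_comm ((n : ℝ) - K), mul_div_mul_left _ _ hnR.ne', div_pow,
      div_mul_eq_mul_div, le_div_iff₀ (pow_pos hd _)]
    refine le_of_mul_le_mul_left ?_ hf
    calc _ = (K.factorial * ∑ A ∈ (Finset.univ.erase k).powersetCard K, ∏ a ∈ A, w k a)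
          * ((n : ℝ) - K) ^ K := by ring
      _ ≤ (∑ a, w k a) ^ K * (K.factorial * (n - 1).choose K) :=
          mul_le_mul (h1.trans h2) h3 (pow_nonneg hd.le _) hW
      _ = _ := by ring
  refine (Finset.prod_le_prod (fun k _ => Finset.sum_nonneg fun A _ =>
    Finset.prod_nonneg fun a _ => hw k a) fun k _ => hfac k).trans ?_
  rw [Finset.prod_mul_distrib, Finset.prod_mul_distrib]
  have hC := card_selectionFamilies n K
  rw [selectionFamilies] at hC
  rw [hC]
  simp only [Finset.prod_const, Finset.card_univ, Fintype.card_fin, Nat.cast_pow]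
  -- The price of drawing without replacement and avoiding `k` itself: each factor is at most `1 +
  -- 2K/n` because `2K ≤ n`, and there are `K n` factors.
  have hexp : ((n / (n - K) : ℝ) ^ K) ^ n ≤ Real.exp (2 * K ^ 2) := by
    have h1 : (n / (n - K) : ℝ) ≤ Real.exp (2 * K / n) := by
      refine le_trans ?_ (Real.add_one_le_exp _)
      rw [div_add_one hnR.ne', div_le_div_iff₀ hd hnR]
      nlinarith [(by positivity : (0 : ℝ) ≤ K)]
    calc ((n / (n - K) : ℝ) ^ K) ^ n ≤ (Real.exp (2 * K / n) ^ K) ^ n := by gcongr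
      _ = Real.exp (2 * K ^ 2) := by
        rw [← Real.exp_nat_mul, ← Real.exp_nat_mul]
        congr 1
        field_simp
  have hW : (0 : ℝ) ≤ ∏ k, ((∑ a, w k a) / n) ^ K :=
    Finset.prod_nonneg fun k _ => pow_nonneg
      (div_nonneg (Finset.sum_nonneg fun a _ => hw k a) hnR.le) _
  gcongr

/-- Markov's inequality for product weights. -/
lemma card_filter_le_of_weight {n K : ℕ} (hn : 2 * K ≤ n) (hn0 : 0 < n)
    (E : (Fin n → Finset (Fin n)) → Prop) [DecidablePred E] (c : ℝ) (hc : 0 ≤ c)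
    (w : Fin n → Fin n → ℝ) (hw : ∀ k a, 0 ≤ w k a)
    (hE : ∀ Γ ∈ selectionFamilies n K, E Γ → 1 ≤ c * ∏ k, ∏ a ∈ Γ k, w k a) :
    (((selectionFamilies n K).filter E).card : ℝ) ≤
      Real.exp (2 * K ^ 2) * (c * ∏ k, ((∑ a, w k a) / n) ^ K) * (selectionFamilies n K).card := by
  calc (((selectionFamilies n K).filter E).card : ℝ)
      = ∑ Γ ∈ (selectionFamilies n K).filter E, (1 : ℝ) := by simp
    _ ≤ ∑ Γ ∈ (selectionFamilies n K).filter E, c * ∏ k, ∏ a ∈ Γ k, w k a := by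
        refine Finset.sum_le_sum fun Γ hΓ => ?_
        rw [Finset.mem_filter] at hΓ
        exact hE Γ hΓ.1 hΓ.2
    _ ≤ ∑ Γ ∈ selectionFamilies n K, c * ∏ k, ∏ a ∈ Γ k, w k a :=
        Finset.sum_le_sum_of_subset_of_nonneg (Finset.filter_subset _ _) fun Γ _ _ =>
          mul_nonneg hc (Finset.prod_nonneg fun k _ => Finset.prod_nonneg fun a _ => hw k a)
    _ ≤ _ := by
        rw [← Finset.mul_sum]
        calc _ ≤ c * _ := mul_le_mul_of_nonneg_left (sum_prod_weight_le hn hn0 w hw) hc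
          _ = _ := by ring

/-! ### Monotonicity in `K` -/

/-- If being bad is inherited by subfamilies, then the proportion of bad selection families
decreases with the size of the selections. -/
lemma card_filter_mul_card_le {n K K' : ℕ} (hK : K ≤ K')
    (E : (Fin n → Finset (Fin n)) → Prop) [DecidablePred E]
    (hE : ∀ Γ Γ', (∀ i, Γ i ⊆ Γ' i) → E Γ' → E Γ) :
    ((selectionFamilies n K').filter E).card * (selectionFamilies n K).card ≤
      ((selectionFamilies n K).filter E).card * (selectionFamilies n K').card := by
  have hsub : ∀ Γ' ∈ selectionFamilies n K',
      ((selectionFamilies n K).filter fun Γ => ∀ i, Γ i ⊆ Γ' i).card = K'.choose K ^ n := by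
    intro Γ' hΓ'
    rw [mem_selectionFamilies] at hΓ'
    have : ((selectionFamilies n K).filter fun Γ => ∀ i, Γ i ⊆ Γ' i) =
        Fintype.piFinset fun i => (Γ' i).powersetCard K := by
      ext Γ
      simp only [Finset.mem_filter, mem_selectionFamilies, Fintype.mem_piFinset,
        Finset.mem_powersetCard]
      exact ⟨fun h i => ⟨h.2 i, (h.1 i).2⟩,
        fun h => ⟨fun i => ⟨fun hi => (hΓ' i).1 ((h i).1 hi), (h i).2⟩, fun i => (h i).1⟩⟩
    rw [this, Fintype.card_piFinset]
    simp [Finset.card_powersetCard, (hΓ' _).2]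
  have hsup : ∀ Γ ∈ selectionFamilies n K,
      ((selectionFamilies n K').filter fun Γ' => ∀ i, Γ i ⊆ Γ' i).card =
        (n - 1 - K).choose (K' - K) ^ n := by
    intro Γ hΓ
    rw [mem_selectionFamilies] at hΓ
    have : ((selectionFamilies n K').filter fun Γ' => ∀ i, Γ i ⊆ Γ' i) =
        Fintype.piFinset fun i => ((Finset.univ.erase i \ Γ i).powersetCard (K' - K)).image
          (Γ i ∪ ·) := by
      ext Γ'
      simp only [Finset.mem_filter, mem_selectionFamilies, Fintype.mem_piFinset,
        Finset.mem_image, Finset.mem_powersetCard]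
      constructor
      · intro h i
        refine ⟨Γ' i \ Γ i, ⟨Finset.sdiff_subset_sdiff ?_ subset_rfl, ?_⟩,
          Finset.union_sdiff_of_subset (h.2 i)⟩
        · rw [Finset.subset_erase]
          exact ⟨Finset.subset_univ _, (h.1 i).1⟩
        · rw [Finset.card_sdiff_of_subset (h.2 i), (h.1 i).2, (hΓ i).2]
      · intro h
        choose A hA hA' using h
        have hA1 : ∀ i a, a ∈ A i → a ≠ i ∧ a ∉ Γ i := by
          intro i a ha
          have := (hA i).1 ha
          simpa using this
        refine ⟨fun i => ⟨?_, ?_⟩, fun i => by rw [← hA' i]; exact Finset.subset_union_left⟩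
        · rw [← hA' i, Finset.mem_union]
          rintro (h | h)
          · exact (hΓ i).1 h
          · exact (hA1 i i h).1 rfl
        · rw [← hA' i, Finset.card_union_of_disjoint, (hΓ i).2, (hA i).2]
          · omega
          · rw [Finset.disjoint_left]
            exact fun a ha ha' => (hA1 i a ha').2 ha
    rw [this, Fintype.card_piFinset]
    have hc : ∀ i, (((Finset.univ.erase i \ Γ i).powersetCard (K' - K)).image
        (Γ i ∪ ·)).card = (n - 1 - K).choose (K' - K) := by
      intro i
      rw [Finset.card_image_of_injOn, Finset.card_powersetCard, Finset.card_sdiff_of_subset]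
      · simp [(hΓ i).2]
      · rw [Finset.subset_erase]
        exact ⟨Finset.subset_univ _, (hΓ i).1⟩
      · intro A hA B hB hAB
        have hd : ∀ C ∈ (↑((Finset.univ.erase i \ Γ i).powersetCard (K' - K)) :
            Set (Finset (Fin n))), Disjoint (Γ i) C := fun C hC =>
          Finset.disjoint_sdiff.mono_right (Finset.mem_powersetCard.1 hC).1
        have h := congrArg (· \ Γ i) hAB
        simpa [Finset.union_sdiff_cancel_left (hd A hA),
          Finset.union_sdiff_cancel_left (hd B hB)] using h
    simp [hc]
  set P := K'.choose K ^ n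
  set Q := (n - 1 - K).choose (K' - K) ^ n
  -- Inclusion is a biregular relation between the two levels. Counting its pairs, first all of them
  -- and then those below bad families, compares the two proportions.
  have h1 : (selectionFamilies n K').card * P = (selectionFamilies n K).card * Q := by
    refine Finset.card_mul_eq_card_mul (fun Γ' Γ => ∀ i, Γ i ⊆ Γ' i) ?_ ?_
    · intro Γ' hΓ'
      exact hsub Γ' hΓ'
    · intro Γ hΓ
      exact hsup Γ hΓ
  have h2 : ((selectionFamilies n K').filter E).card * P ≤
      ((selectionFamilies n K).filter E).card * Q := by
    refine Finset.card_mul_le_card_mul (fun Γ' Γ => ∀ i, Γ i ⊆ Γ' i) ?_ ?_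
    · intro Γ' hΓ'
      rw [Finset.mem_filter] at hΓ'
      rw [← hsub Γ' hΓ'.1]
      refine Finset.card_le_card fun Γ hΓ => ?_
      rw [Finset.mem_filter] at hΓ
      rw [Finset.mem_bipartiteAbove, Finset.mem_filter]
      exact ⟨⟨hΓ.1, hE Γ Γ' hΓ.2 hΓ'.2⟩, hΓ.2⟩
    · intro Γ hΓ
      rw [Finset.mem_filter] at hΓ
      rw [← hsup Γ hΓ.1]
      refine Finset.card_le_card fun Γ' hΓ' => ?_
      rw [Finset.mem_bipartiteBelow, Finset.mem_filter] at hΓ'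
      rw [Finset.mem_filter]
      exact ⟨hΓ'.1.1, hΓ'.2⟩
  have hP : 0 < P := pow_pos (Nat.choose_pos hK) _
  refine Nat.le_of_mul_le_mul_right ?_ hP
  calc _ = ((selectionFamilies n K').filter E).card * P * (selectionFamilies n K).card := by ring
    _ ≤ ((selectionFamilies n K).filter E).card * Q * (selectionFamilies n K).card := by gcongr
    _ = ((selectionFamilies n K).filter E).card * ((selectionFamilies n K').card * P) := by
        rw [h1]; ring
    _ = _ := by ring

/-! ### Sets that are not reachable -/

lemma graph_adj {n : ℕ} {Γ : Fin n → Finset (Fin n)} {i j : Fin n} :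
    (graph Γ).Adj i j ↔ i ≠ j ∧ (j ∈ Γ i ∨ i ∈ Γ j) := by
  simp [graph, SimpleGraph.fromRel_adj]

/-- Of two disjoint sets of nodes one has at most half of the nodes. -/
lemma exists_not_isReachable_of_not_isRobust {n r : ℕ} {G : SimpleGraph (Fin n)}
    (h : ¬ IsRobust G r) :
    ∃ S : Finset (Fin n), 1 ≤ S.card ∧ 2 * S.card ≤ n ∧ ¬ IsReachable G r (S : Set (Fin n)) := by
  classical
  simp only [IsRobust, not_forall, not_or] at h
  obtain ⟨S, S', hS, hS', hd, h1, h2⟩ := h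
  have hd' : Disjoint S.toFinset S'.toFinset := by simpa using hd
  have hc : S.toFinset.card + S'.toFinset.card ≤ n := by
    rw [← Finset.card_union_of_disjoint hd']
    simpa using Finset.card_le_univ (S.toFinset ∪ S'.toFinset)
  rcases le_total S.toFinset.card S'.toFinset.card with hle | hle
  · exact ⟨S.toFinset, Finset.card_pos.2 (by simpa using hS), by omega, by simpa using h1⟩
  · exact ⟨S'.toFinset, Finset.card_pos.2 (by simpa using hS'), by omega, by simpa using h2⟩

lemma IsReachable.mono {n r : ℕ} {G H : SimpleGraph (Fin n)} (hGH : G ≤ H) {S : Set (Fin n)}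
    (h : IsReachable G r S) : IsReachable H r S := by
  obtain ⟨i, hi, hr⟩ := h
  refine ⟨i, hi, hr.trans (Set.ncard_le_ncard ?_ (Set.toFinite _))⟩
  exact Set.sdiff_subset_sdiff_left fun j hj => hGH hj

lemma IsRobust.mono {n r : ℕ} {G H : SimpleGraph (Fin n)} (hGH : G ≤ H)
    (h : IsRobust G r) : IsRobust H r :=
  fun S S' hS hS' hd => (h S S' hS hS' hd).imp (·.mono hGH) (·.mono hGH)

lemma graph_mono {n : ℕ} {Γ Γ' : Fin n → Finset (Fin n)} (h : ∀ i, Γ i ⊆ Γ' i) :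
    graph Γ ≤ graph Γ' := by
  intro i j hij
  rw [graph_adj] at hij ⊢
  exact ⟨hij.1, hij.2.imp (@h i j) (@h j i)⟩

/-- The number of ordered pairs of nodes that select each other. -/
def mutualCount {n : ℕ} (Γ : Fin n → Finset (Fin n)) : ℕ :=
  ∑ i, ((Γ i).filter fun j => i ∈ Γ j).card

/-- Inclusion–exclusion: an outside neighbour is counted twice only if it and `i` select each other.
-/
lemma card_add_card_lt_of_not_isReachable {n r : ℕ} {Γ : Fin n → Finset (Fin n)}
    {S : Finset (Fin n)} (h : ¬ IsReachable (graph Γ) r (S : Set (Fin n))) {i : Fin n}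
    (hi : i ∈ S) :
    (Γ i \ S).card + (Sᶜ.filter fun j => i ∈ Γ j).card <
      r + ((Γ i).filter fun j => i ∈ Γ j).card := by
  have h1 : ((graph Γ).neighborSet i \ S).ncard < r := by
    by_contra hc
    exact h ⟨i, by simpa using hi, not_lt.1 hc⟩
  have h2 : ((Γ i \ S) ∪ (Sᶜ.filter fun j => i ∈ Γ j)).card ≤
      ((graph Γ).neighborSet i \ S).ncard := by
    rw [← Set.ncard_coe_finset]
    refine Set.ncard_le_ncard ?_ (Set.toFinite _)
    intro j hj
    simp only [Finset.coe_union, Finset.coe_sdiff, Set.mem_union, Set.mem_sdiff, Finset.mem_coe,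
      Finset.mem_filter, Finset.mem_compl] at hj
    have hjS : j ∉ S := hj.elim (·.2) (·.1)
    refine ⟨?_, by simpa using hjS⟩
    rw [SimpleGraph.mem_neighborSet, graph_adj]
    exact ⟨fun e => hjS (e ▸ hi), hj.imp (·.1) (·.2)⟩
  have h3 := Finset.card_union_add_card_inter (Γ i \ S) (Sᶜ.filter fun j => i ∈ Γ j)
  have h4 : ((Γ i \ S) ∩ (Sᶜ.filter fun j => i ∈ Γ j)).card ≤
      ((Γ i).filter fun j => i ∈ Γ j).card := by
    refine Finset.card_le_card fun j hj => ?_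
    simp only [Finset.mem_inter, Finset.mem_sdiff, Finset.mem_filter] at hj ⊢
    exact ⟨hj.1.1, hj.2.2⟩
  omega

lemma card_sdiff_lt_of_not_isReachable {n r : ℕ} {Γ : Fin n → Finset (Fin n)}
    {S : Finset (Fin n)} (h : ¬ IsReachable (graph Γ) r (S : Set (Fin n))) {i : Fin n}
    (hi : i ∈ S) : (Γ i \ S).card < r := by
  have h2 : ((graph Γ).neighborSet i \ S).ncard < r := by
    by_contra hc
    exact h ⟨i, by simpa using hi, not_lt.1 hc⟩
  refine lt_of_le_of_lt ?_ h2
  rw [← Set.ncard_coe_finset]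
  refine Set.ncard_le_ncard ?_ (Set.toFinite _)
  intro j hj
  simp only [Finset.coe_sdiff, Set.mem_sdiff, Finset.mem_coe] at hj
  refine ⟨?_, by simpa using hj.2⟩
  rw [SimpleGraph.mem_neighborSet, graph_adj]
  exact ⟨fun e => hj.2 (e ▸ hi), Or.inl hj.1⟩

/-- The number of selections between a set that is not reachable and its complement. -/
lemma sum_crossing_le_of_not_isReachable {n r : ℕ} {Γ : Fin n → Finset (Fin n)}
    {S : Finset (Fin n)} (h : ¬ IsReachable (graph Γ) r (S : Set (Fin n))) :
    ∑ i ∈ S, (Γ i \ S).card + ∑ j ∈ Sᶜ, (Γ j ∩ S).card + S.card ≤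
      r * S.card + mutualCount Γ := by
  -- The `+ 1` keeps the strictness at each node, which turns `r` into `r - 1`; for `r = 1` this
  -- gain is essential.
  have h1 : ∑ i ∈ S, ((Γ i \ S).card + (Sᶜ.filter fun j => i ∈ Γ j).card + 1) ≤
      ∑ i ∈ S, (r + ((Γ i).filter fun j => i ∈ Γ j).card) :=
    Finset.sum_le_sum fun i hi => card_add_card_lt_of_not_isReachable h hi
  have h2 : ∑ i ∈ S, (Sᶜ.filter fun j => i ∈ Γ j).card = ∑ j ∈ Sᶜ, (Γ j ∩ S).card := by
    have := Finset.sum_card_bipartiteAbove_eq_sum_card_bipartiteBelow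
      (s := S) (t := Sᶜ) (fun i j => i ∈ Γ j)
    rw [show (∑ i ∈ S, (Sᶜ.filter fun j => i ∈ Γ j).card) = _ from this]
    refine Finset.sum_congr rfl fun j _ => ?_
    congr 1
    ext i
    simp [Finset.mem_bipartiteBelow, and_comm]
  have h3 : ∑ i ∈ S, ((Γ i).filter fun j => i ∈ Γ j).card ≤ mutualCount Γ :=
    Finset.sum_le_sum_of_subset (Finset.subset_univ _)
  rw [Finset.sum_add_distrib, Finset.sum_add_distrib, Finset.sum_add_distrib, h2] at h1
  simp only [Finset.sum_const, smul_eq_mul, mul_one] at h1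
  rw [mul_comm r]
  omega

lemma prod_ite_mem {α : Type*} [DecidableEq α] (A S : Finset α) (θ : ℝ) :
    ∏ a ∈ A, (if a ∈ S then 1 else θ) = θ ^ (A \ S).card := by
  rw [Finset.prod_ite, Finset.prod_const_one, one_mul, Finset.prod_const, Finset.filter_notMem_eq_sdiff]

lemma prod_ite_mem' {α : Type*} [DecidableEq α] (A S : Finset α) (θ : ℝ) :
    ∏ a ∈ A, (if a ∈ S then θ else 1) = θ ^ (A ∩ S).card := by
  rw [Finset.prod_ite, Finset.prod_const_one, mul_one, Finset.prod_const, Finset.filter_mem_eq_inter]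

lemma sum_ite_mem_card {n : ℕ} (S : Finset (Fin n)) (x y : ℝ) :
    ∑ a, (if a ∈ S then x else y) = S.card * x + (n - S.card) * y := by
  rw [Finset.sum_ite, Finset.sum_const, Finset.sum_const, Finset.filter_notMem_eq_sdiff,
    ← Finset.compl_eq_univ_sdiff, Finset.card_compl, Finset.filter_mem_eq_inter, Finset.univ_inter,
    Fintype.card_fin, nsmul_eq_mul, nsmul_eq_mul,
    Nat.cast_sub (by simpa using Finset.card_le_univ S)]

/-! ### Probability estimates for mutual pairs and for a fixed set -/

open Classical in
/-- Few pairs of nodes select each other. -/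
lemma card_filter_mutualCount_le {n K : ℕ} (hn : 2 * K ≤ n) (hn0 : 0 < n) :
    (((selectionFamilies n K).filter fun Γ => n ≤ 48 * mutualCount Γ).card : ℝ) ≤
      48 * (Real.exp (2 * K ^ 2) * 4 ^ K) / n * (selectionFamilies n K).card := by
  have hnR : (0 : ℝ) < n := by exact_mod_cast hn0
  set N : ℝ := ((selectionFamilies n K).card : ℝ)
  have hpair : ∀ i j : Fin n,
      (((selectionFamilies n K).filter fun Γ => j ∈ Γ i ∧ i ∈ Γ j).card : ℝ) ≤
        Real.exp (2 * K ^ 2) * 4 ^ K / n ^ 2 * N := by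
    intro i j
    rcases eq_or_ne i j with rfl | hij
    · rw [Finset.filter_false_of_mem]
      · simp only [Finset.card_empty, Nat.cast_zero]; positivity
      · intro Γ hΓ h
        exact (mem_selectionFamilies.1 hΓ i).1 h.1
    have hone : (1 : ℝ) ≤ n := by exact_mod_cast hn0
    -- Weight `n` on the two relevant selections gains `n ^ 2` on the event, while rows `i` and `j`
    -- only reach mean weight at most `2`, whence `(2 ^ K) ^ 2 = 4 ^ K`.
    let w : Fin n → Fin n → ℝ := fun k a => if (k = i ∧ a = j) ∨ (k = j ∧ a = i) then n else 1
    have hw1 : ∀ k a, 1 ≤ w k a := by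
      intro k a; simp only [w]; split_ifs <;> simp [hone]
    have hw : ∀ k a, 0 ≤ w k a := fun k a => zero_le_one.trans (hw1 k a)
    have h := card_filter_le_of_weight hn hn0 (fun Γ => j ∈ Γ i ∧ i ∈ Γ j) ((n : ℝ) ^ 2)⁻¹
      (by positivity) w hw (by
        intro Γ _ hE
        rw [← div_eq_inv_mul, one_le_div (by positivity)]
        have hk : ∀ k, 1 ≤ ∏ a ∈ Γ k, w k a := fun k => Finset.one_le_prod fun a _ => hw1 k a
        have hlow : ∀ k b, b ∈ Γ k → w k b = n → (n : ℝ) ≤ ∏ a ∈ Γ k, w k a := by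
          intro k b hb hwb
          rw [← Finset.mul_prod_erase _ _ hb, hwb]
          exact le_mul_of_one_le_right hnR.le (Finset.one_le_prod fun a _ => hw1 k a)
        rw [← Finset.mul_prod_erase _ _ (Finset.mem_univ i), ← Finset.mul_prod_erase _ _
          (Finset.mem_erase.2 ⟨hij.symm, Finset.mem_univ j⟩), sq]
        refine mul_le_mul (hlow i j hE.1 (by simp [w])) ?_ hnR.le (zero_le_one.trans (hk i))
        refine (hlow j i hE.2 (by simp [w])).trans (le_mul_of_one_le_right
          (zero_le_one.trans (hk j)) (Finset.one_le_prod fun a _ => hk a)))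
    refine h.trans ?_
    have hW : ∏ k, ((∑ a, w k a) / n) ^ K ≤ 4 ^ K := by
      have hsum : ∀ k, ∑ a, w k a ≤ if k = i ∨ k = j then 2 * (n : ℝ) else n := by
        intro k
        split_ifs with hk
        · have : ∃ b, ∀ a, w k a ≤ 1 + if a = b then (n : ℝ) else 0 := by
            rcases hk with rfl | rfl
            · refine ⟨j, fun a => ?_⟩
              simp only [w, true_and, hij, false_and, or_false]
              split_ifs <;> simp
            · refine ⟨i, fun a => ?_⟩
              simp only [w, true_and, hij.symm, false_and, false_or]
              split_ifs <;> simp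
          obtain ⟨b, hb⟩ := this
          refine (Finset.sum_le_sum fun a _ => hb a).trans ?_
          rw [Finset.sum_add_distrib, Finset.sum_ite_eq']
          simp [two_mul]
        · rw [not_or] at hk
          simp [w, hk.1, hk.2]
      have hsum' : ∀ k, ((∑ a, w k a) / n) ^ K ≤ if k = i ∨ k = j then 2 ^ K else (1 : ℝ) := by
        intro k
        have h0 : 0 ≤ (∑ a, w k a) / n :=
          div_nonneg (Finset.sum_nonneg fun a _ => hw k a) hnR.le
        have := hsum k
        split_ifs at this ⊢ with hk
        · exact pow_le_pow_left₀ h0 ((div_le_iff₀ hnR).2 this) _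
        · exact pow_le_one₀ h0 ((div_le_one hnR).2 this)
      refine (Finset.prod_le_prod (fun k _ => pow_nonneg
        (div_nonneg (Finset.sum_nonneg fun a _ => hw k a) hnR.le) _) fun k _ => hsum' k).trans ?_
      rw [Finset.prod_ite, Finset.prod_const_one, mul_one, Finset.prod_const]
      rw [show (Finset.univ.filter fun k => k = i ∨ k = j) = {i, j} by ext; simp,
        Finset.card_pair hij, ← pow_mul, mul_comm, pow_mul]
      norm_num
    calc _ ≤ Real.exp (2 * K ^ 2) * (((n : ℝ) ^ 2)⁻¹ * 4 ^ K) * N := by gcongr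
      _ = _ := by ring
  have hE : ∑ Γ ∈ selectionFamilies n K, (mutualCount Γ : ℝ) ≤ Real.exp (2 * K ^ 2) * 4 ^ K * N := by
    have hm : ∀ Γ : Fin n → Finset (Fin n), (mutualCount Γ : ℝ) =
        ∑ i, ∑ j, if j ∈ Γ i ∧ i ∈ Γ j then (1 : ℝ) else 0 := by
      intro Γ
      rw [mutualCount, Nat.cast_sum]
      refine Finset.sum_congr rfl fun i _ => ?_
      rw [← Finset.sum_filter, Finset.sum_const, nsmul_one]
      congr 2
      ext j; simp
    simp only [hm]
    rw [Finset.sum_comm]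
    simp only [Finset.sum_comm (s := selectionFamilies n K)]
    calc ∑ i : Fin n, ∑ j : Fin n, ∑ Γ ∈ selectionFamilies n K,
          (if j ∈ Γ i ∧ i ∈ Γ j then (1 : ℝ) else 0)
        ≤ ∑ i : Fin n, ∑ j : Fin n, Real.exp (2 * K ^ 2) * 4 ^ K / n ^ 2 * N := by
          refine Finset.sum_le_sum fun i _ => Finset.sum_le_sum fun j _ => ?_
          rw [← Finset.sum_filter, Finset.sum_const, nsmul_one]
          exact hpair i j
      _ = _ := by
          simp only [Finset.sum_const, Finset.card_univ, Fintype.card_fin, nsmul_eq_mul]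
          field_simp
  have hM : (((selectionFamilies n K).filter fun Γ => n ≤ 48 * mutualCount Γ).card : ℝ) * n ≤
      48 * ∑ Γ ∈ selectionFamilies n K, (mutualCount Γ : ℝ) := by
    rw [← nsmul_eq_mul, ← Finset.sum_const, Finset.mul_sum]
    refine (Finset.sum_le_sum fun Γ hΓ => ?_).trans
      (Finset.sum_le_sum_of_subset_of_nonneg (Finset.filter_subset _ _)
        fun Γ _ _ => (by positivity))
    exact_mod_cast (Finset.mem_filter.1 hΓ).2
  rw [div_mul_eq_mul_div, le_div_iff₀ hnR]
  linarith

-- Only selections made by nodes of `S` are used, so mutual pairs play no role. With `p = |S| / n`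
-- as weight of an outgoing selection, a row of `S` has mean at most `2p`; each node thus costs `p ^
-- (1 - r) * (2p) ^ (2r) = p * (4p) ^ r`.
open Classical in
lemma card_filter_not_isReachable_small {n r : ℕ} (hr : 1 ≤ r) (hn : 2 * (2 * r) ≤ n)
    (S : Finset (Fin n)) (hS : 1 ≤ S.card) :
    (((selectionFamilies n (2 * r)).filter
        fun Γ => ¬ IsReachable (graph Γ) r (S : Set (Fin n))).card : ℝ) ≤
      Real.exp (2 * (2 * r : ℕ) ^ 2) * ((S.card / n : ℝ) * (4 * (S.card / n)) ^ r) ^ S.card *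
        (selectionFamilies n (2 * r)).card := by
  have hn0 : 0 < n := by omega
  have hnR : (0 : ℝ) < n := by exact_mod_cast hn0
  have hSR : (0 : ℝ) < S.card := by exact_mod_cast hS
  have hSn : (S.card : ℝ) ≤ n := by
    have := Finset.card_le_univ S
    rw [Fintype.card_fin] at this
    exact_mod_cast this
  set p : ℝ := S.card / n with hp
  have hp0 : 0 < p := by positivity
  have hp1 : p ≤ 1 := (div_le_one hnR).2 hSn
  let w : Fin n → Fin n → ℝ := fun k a => if k ∈ S then (if a ∈ S then 1 else p) else 1
  have hw : ∀ k a, 0 ≤ w k a := by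
    intro k a; simp only [w]; split_ifs <;> first | exact hp0.le | exact zero_le_one
  have h := card_filter_le_of_weight hn hn0
    (fun Γ => ¬ IsReachable (graph Γ) r (S : Set (Fin n))) ((p⁻¹ ^ (r - 1)) ^ S.card)
    (by positivity) w hw (by
      intro Γ _ hE
      have h1 : ∏ k, ∏ a ∈ Γ k, w k a = ∏ k ∈ S, p ^ (Γ k \ S).card := by
        rw [← Finset.prod_mul_prod_compl S]
        rw [Finset.prod_congr rfl (g := fun k => p ^ (Γ k \ S).card), Finset.prod_eq_one (s := Sᶜ),
          mul_one]
        · intro k hk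
          simp [w, Finset.mem_compl.1 hk]
        · intro k hk
          simp only [w, hk, if_true]
          exact prod_ite_mem _ _ _
      rw [h1, ← Finset.prod_const, ← Finset.prod_mul_distrib]
      refine Finset.one_le_prod fun k hk => ?_
      have h2 := card_sdiff_lt_of_not_isReachable hE hk
      rw [inv_pow, ← div_eq_inv_mul, one_le_div (by positivity)]
      exact pow_le_pow_of_le_one hp0.le hp1 (by omega))
  refine h.trans ?_
  have hW : ∏ k, ((∑ a, w k a) / n) ^ (2 * r) ≤ ((2 * p) ^ (2 * r)) ^ S.card := by
    rw [← Finset.prod_mul_prod_compl S, ← Finset.prod_const,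
      Finset.prod_eq_one (s := Sᶜ), mul_one]
    · refine Finset.prod_le_prod (fun k _ => pow_nonneg
        (div_nonneg (Finset.sum_nonneg fun a _ => hw k a) hnR.le) _) fun k hk => ?_
      refine pow_le_pow_left₀ (div_nonneg (Finset.sum_nonneg fun a _ => hw k a) hnR.le) ?_ _
      simp only [w, hk, if_true]
      rw [sum_ite_mem_card, div_le_iff₀ hnR]
      have : p * n = S.card := by rw [hp]; field_simp
      nlinarith
    · intro k hk
      simp [w, Finset.mem_compl.1 hk, hnR.ne']
  have hval : (p⁻¹ ^ (r - 1)) ^ S.card * ((2 * p) ^ (2 * r)) ^ S.card =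
      (p * (4 * p) ^ r) ^ S.card := by
    rw [← mul_pow]
    congr 1
    obtain ⟨s, rfl⟩ : ∃ s, r = s + 1 := ⟨r - 1, by omega⟩
    rw [Nat.add_sub_cancel, pow_mul, inv_pow, inv_mul_eq_iff_eq_mul₀ (by positivity)]
    rw [show (2 * p) ^ 2 = (4 * p) * p by ring, mul_pow _ p]
    ring
  rw [← hval]
  gcongr

-- Both directions across the cut carry the weight `16 / 81`, since the bound must compete with
-- exponentially many sets `S`.
open Classical in
lemma card_filter_not_isReachable_large {n r : ℕ} (hr : 1 ≤ r) (hn : 2 * (2 * r) ≤ n)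
    (S : Finset (Fin n)) :
    (((selectionFamilies n (2 * r)).filter
        fun Γ => ¬ IsReachable (graph Γ) r (S : Set (Fin n)) ∧ 4 * mutualCount Γ ≤ S.card).card : ℝ) ≤
      Real.exp (2 * (2 * r : ℕ) ^ 2) * ((3 / 2) ^ ((4 * r - 3) * S.card) *
        (((S.card + (n - S.card) * (16 / 81)) / n) ^ (2 * r)) ^ S.card *
        (((S.card * (16 / 81) + (n - S.card)) / n) ^ (2 * r)) ^ (n - S.card)) *
        (selectionFamilies n (2 * r)).card := by
  have hn0 : 0 < n := by omega
  have hcc : Sᶜ.card = n - S.card := by rw [Finset.card_compl, Fintype.card_fin]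
  let w : Fin n → Fin n → ℝ := fun k a =>
    if k ∈ S then (if a ∈ S then 1 else 16 / 81) else (if a ∈ S then 16 / 81 else 1)
  have hw : ∀ k a, 0 ≤ w k a := by
    intro k a; simp only [w]; split_ifs <;> norm_num
  have h := card_filter_le_of_weight hn hn0
    (fun Γ => ¬ IsReachable (graph Γ) r (S : Set (Fin n)) ∧ 4 * mutualCount Γ ≤ S.card)
    ((3 / 2) ^ ((4 * r - 3) * S.card)) (by positivity) w hw (by
      intro Γ _ hE
      have h1 : ∏ k, ∏ a ∈ Γ k, w k a =
          (16 / 81) ^ (∑ i ∈ S, (Γ i \ S).card + ∑ j ∈ Sᶜ, (Γ j ∩ S).card) := by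
        rw [← Finset.prod_mul_prod_compl S, pow_add, ← Finset.prod_pow_eq_pow_sum,
          ← Finset.prod_pow_eq_pow_sum]
        congr 1
        · refine Finset.prod_congr rfl fun k hk => ?_
          simp only [w, hk, if_true]
          exact prod_ite_mem _ _ _
        · refine Finset.prod_congr rfl fun k hk => ?_
          simp only [w, Finset.mem_compl.1 hk, if_false]
          exact prod_ite_mem' _ _ _
      have h2 := sum_crossing_le_of_not_isReachable hE.1
      -- A fourth power keeps exponents integral: `4 * mutualCount Γ ≤ |S|` gives four times the
      -- crossing count at most `(4r - 3) |S|`.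
      rw [h1, show (16 / 81 : ℝ) = (3 / 2)⁻¹ ^ 4 by norm_num, ← pow_mul, inv_pow,
        ← div_eq_mul_inv, one_le_div (by positivity)]
      refine pow_le_pow_right₀ (by norm_num) ?_
      have h3 := hE.2
      rw [Nat.sub_mul, mul_assoc]
      omega)
  refine h.trans (le_of_eq ?_)
  congr 2
  rw [mul_assoc]
  congr 1
  rw [← Finset.prod_mul_prod_compl S, ← hcc]
  congr 1
  · rw [← Finset.prod_const]
    refine Finset.prod_congr rfl fun k hk => ?_
    simp only [w, hk, if_true]
    rw [sum_ite_mem_card, mul_one]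
  · rw [← Finset.prod_const]
    refine Finset.prod_congr rfl fun k hk => ?_
    simp only [w, Finset.mem_compl.1 hk, if_false]
    rw [sum_ite_mem_card, mul_one]

/-! ### Weighing the bounds against the number of sets -/

/-- With `p = m / n`, the factor `p ^ m` absorbs the binomial coefficient up to `e ^ m`. As `4e <
11`, this leaves `(11p) ^ m`: one factor supplies `1 / n`, and the others are below `11 / 12`, which
makes the sum over `m` converge. -/
lemma choose_mul_small_le {n m r : ℕ} (hr : 1 ≤ r) (hm : 1 ≤ m) (hmn : 12 * m < n) :
    (n.choose m : ℝ) * ((m / n : ℝ) * (4 * (m / n)) ^ r) ^ m ≤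
      11 / n * (m * (11 / 12) ^ (m - 1)) := by
  have hnR : (0 : ℝ) < n := by exact_mod_cast (by omega : 0 < n)
  have hmR : (0 : ℝ) < m := by exact_mod_cast hm
  have hmnR : (12 : ℝ) * m < n := by exact_mod_cast hmn
  have hp12 : (m / n : ℝ) ≤ 1 / 12 := by rw [div_le_iff₀ hnR]; linarith
  have hp0 : (0 : ℝ) < m / n := by positivity
  have h1 : (n.choose m : ℝ) * (m / n) ^ m ≤ Real.exp m := by
    calc (n.choose m : ℝ) * (m / n) ^ m ≤ n ^ m / m.factorial * (m / n) ^ m := by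
          gcongr; exact Nat.choose_le_pow_div m n
      _ = (m : ℝ) ^ m / m.factorial := by
          rw [div_pow]; field_simp
      _ ≤ Real.exp m := Real.pow_div_factorial_le_exp _ hmR.le _
  have h2 : (4 * (m / n : ℝ)) ^ r ≤ 4 * (m / n) :=
    pow_le_of_le_one (by positivity) (by linarith) (by omega)
  have h3 : Real.exp 1 * (4 * (m / n : ℝ)) ≤ 11 * (m / n) := by
    have := Real.exp_one_lt_d9
    nlinarith
  obtain ⟨l, rfl⟩ : ∃ l, m = l + 1 := ⟨m - 1, by omega⟩
  set p : ℝ := ((l + 1 : ℕ) : ℝ) / n with hp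
  calc (n.choose (l + 1) : ℝ) * (p * (4 * p) ^ r) ^ (l + 1)
      = (n.choose (l + 1) * p ^ (l + 1)) * ((4 * p) ^ r) ^ (l + 1) := by rw [mul_pow]; ring
    _ ≤ Real.exp (l + 1 : ℕ) * (4 * p) ^ (l + 1) := by gcongr
    _ = (Real.exp 1 * (4 * p)) ^ (l + 1) := by
        rw [mul_pow (Real.exp 1), ← Real.exp_nat_mul, mul_one]
    _ ≤ (11 * p) ^ (l + 1) := by gcongr
    _ = 11 * p * (11 * p) ^ l := by ring
    _ ≤ 11 * p * (11 / 12) ^ l := by gcongr; linarith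
    _ = _ := by rw [hp, Nat.add_sub_cancel]; ring

lemma choose_mul_large_le {n m r : ℕ} (hr : 1 ≤ r) (hn : 0 < n) (hmn : n ≤ 12 * m)
    (hmn' : 2 * m ≤ n) :
    (n.choose m : ℝ) * ((3 / 2) ^ ((4 * r - 3) * m) *
        (((m + (n - m) * (16 / 81)) / n) ^ (2 * r)) ^ m *
        (((m * (16 / 81) + (n - m)) / n) ^ (2 * r)) ^ (n - m)) ≤ (49 / 50 : ℝ) ^ n := by
  have hnR : (0 : ℝ) < n := by exact_mod_cast hn
  set p : ℝ := m / n with hp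
  have hm : (m : ℝ) = p * n := by rw [hp]; field_simp
  have hp1 : 1 / 12 ≤ p := by
    have : (n : ℝ) ≤ 12 * m := by exact_mod_cast hmn
    rw [hp, le_div_iff₀ hnR]; linarith
  have hp2 : p ≤ 1 / 2 := by
    have : (2 : ℝ) * m ≤ n := by exact_mod_cast hmn'
    rw [hp, div_le_iff₀ hnR]; linarith
  have ha : ((m + (n - m) * (16 / 81)) / n : ℝ) = p + (1 - p) * (16 / 81) := by
    rw [hm]; field_simp
  have hb : ((m * (16 / 81) + (n - m)) / n : ℝ) = p * (16 / 81) + (1 - p) := by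
    rw [hm]; field_simp
  rw [ha, hb]
  set a : ℝ := p + (1 - p) * (16 / 81) with ha'
  set b : ℝ := p * (16 / 81) + (1 - p) with hb'
  have ha0 : 0 ≤ a := by nlinarith
  have hb0 : 0 ≤ b := by nlinarith
  obtain ⟨s, rfl⟩ : ∃ s, r = s + 1 := ⟨r - 1, by omega⟩
  have hle : m ≤ n := by omega
  -- The case `r = 1`. The left side is one term of a binomial expansion, and `3 / 2 * a ^ 2 + b ^
  -- 2` is convex in `p`, so its maximum on `[1/12, 1/2]` is at an endpoint (about `0.976`, at
  -- `1/12`).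
  have hfirst : (n.choose m : ℝ) * ((3 / 2 * a ^ 2) ^ m * (b ^ 2) ^ (n - m)) ≤ (49 / 50 : ℝ) ^ n := by
    calc _ ≤ (3 / 2 * a ^ 2 + b ^ 2) ^ n := by
          rw [add_pow (3 / 2 * a ^ 2)]
          refine le_trans (le_of_eq ?_) (Finset.single_le_sum
            (f := fun k => (3 / 2 * a ^ 2) ^ k * (b ^ 2) ^ (n - k) * (n.choose k : ℝ))
            (fun k _ => by positivity) (Finset.mem_range.2 (Nat.lt_succ_of_le hle)))
          ring
      _ ≤ _ := by
          refine pow_le_pow_left₀ (by positivity) ?_ _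
          rw [ha', hb']
          nlinarith [mul_nonneg (sub_nonneg.2 hp1) (sub_nonneg.2 hp2)]
  -- Raising `r` by one multiplies the bound by the square of this quantity. After `x ≤ exp (x -
  -- 1)`, the exponent is again convex in `p`.
  have hsecond : (9 / 4 * a) ^ m * b ^ (n - m) ≤ 1 := by
    calc (9 / 4 * a) ^ m * b ^ (n - m)
        ≤ Real.exp (9 / 4 * a - 1) ^ m * Real.exp (b - 1) ^ (n - m) := by
          gcongr
          · linarith [Real.add_one_le_exp (9 / 4 * a - 1)]
          · linarith [Real.add_one_le_exp (b - 1)]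
      _ = Real.exp (n * (p * (9 / 4 * a) + (1 - p) * b - 1)) := by
          rw [← Real.exp_nat_mul, ← Real.exp_nat_mul, ← Real.exp_add, Nat.cast_sub hle, hm]
          congr 1
          ring
      _ ≤ 1 := by
          rw [Real.exp_le_one_iff]
          refine mul_nonpos_of_nonneg_of_nonpos hnR.le ?_
          rw [ha', hb']
          nlinarith [mul_nonneg (sub_nonneg.2 hp1) (sub_nonneg.2 hp2)]
  calc _ = ((n.choose m : ℝ) * ((3 / 2 * a ^ 2) ^ m * (b ^ 2) ^ (n - m))) *
        ((9 / 4 * a) ^ m * b ^ (n - m)) ^ (2 * s) := by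
        rw [show 4 * (s + 1) - 3 = 1 + 4 * s by omega]
        rw [show (9 / 4 : ℝ) = (3 / 2) ^ 2 by norm_num]
        simp only [mul_pow, ← pow_mul]
        ring
    _ ≤ (49 / 50 : ℝ) ^ n * 1 := by
        gcongr
        exact pow_le_one₀ (by positivity) hsecond
    _ = _ := mul_one _

/-! ### Union bound and limit -/

/-- A bound on the probability that the graph is not robust. -/
noncomputable def failureBound (r n : ℕ) : ℝ :=
  Real.exp (2 * (2 * r : ℕ) ^ 2) * (48 * 4 ^ (2 * r) / n +
    (11 / n * ∑' m : ℕ, (m * (11 / 12 : ℝ) ^ (m - 1)) + (n + 1) * (49 / 50 : ℝ) ^ n))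

lemma summable_mul_geometric : Summable fun m : ℕ => (m * (11 / 12 : ℝ) ^ (m - 1)) := by
  rw [← summable_nat_add_iff 1]
  simp only [Nat.add_sub_cancel, Nat.cast_add, Nat.cast_one, add_mul, one_mul]
  have h1 := summable_pow_mul_geometric_of_norm_lt_one (R := ℝ) 1 (r := 11 / 12)
    (by rw [Real.norm_of_nonneg] <;> norm_num)
  simp only [pow_one] at h1
  exact h1.add (summable_geometric_of_lt_one (by norm_num) (by norm_num))

lemma tendsto_failureBound (r : ℕ) : Tendsto (failureBound r) atTop (𝓝 0) := by
  unfold failureBound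
  have h1 : ∀ c : ℝ, Tendsto (fun n : ℕ => c / (n : ℝ)) atTop (𝓝 0) := fun c =>
    tendsto_const_div_atTop_nhds_zero_nat c
  have h2 : Tendsto (fun n : ℕ => ((n : ℝ) + 1) * (49 / 50 : ℝ) ^ n) atTop (𝓝 0) := by
    have ha := tendsto_self_mul_const_pow_of_lt_one (r := (49 / 50 : ℝ)) (by norm_num) (by norm_num)
    have hb := tendsto_pow_atTop_nhds_zero_of_lt_one (r := (49 / 50 : ℝ)) (by norm_num)
      (by norm_num)
    simpa [add_mul] using ha.add hb
  simpa using ((h1 _).add (((h1 11).mul_const _).add h2)).const_mul _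

-- The event of many mutual pairs is removed once, before the union over `S`: its `O(1/n)` bound
-- would not survive a sum over sets. The threshold is `48 = 4 * 12`, so off this event `12 |S| ≥ n`
-- forces `4 * mutualCount Γ ≤ |S|`.
open Classical in
lemma card_filter_not_isRobust_le {n r : ℕ} (hr : 1 ≤ r) (hn : 2 * (2 * r) ≤ n) :
    (((selectionFamilies n (2 * r)).filter fun Γ => ¬ IsRobust (graph Γ) r).card : ℝ) ≤
      failureBound r n * (selectionFamilies n (2 * r)).card := by
  have hn0 : 0 < n := by omega
  set N := selectionFamilies n (2 * r) with hN
  set C : ℝ := Real.exp (2 * (2 * r : ℕ) ^ 2) with hC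
  let F : Finset (Fin n) → Finset (Fin n → Finset (Fin n)) := fun S =>
    if 1 ≤ S.card ∧ 2 * S.card ≤ n then
      if 12 * S.card < n then N.filter fun Γ => ¬ IsReachable (graph Γ) r (S : Set (Fin n))
      else N.filter fun Γ => ¬ IsReachable (graph Γ) r (S : Set (Fin n)) ∧
        4 * mutualCount Γ ≤ S.card
    else ∅
  let g : ℕ → ℝ := fun m =>
    if 1 ≤ m ∧ 2 * m ≤ n then
      if 12 * m < n then ((m / n : ℝ) * (4 * (m / n)) ^ r) ^ m
      else ((3 / 2) ^ ((4 * r - 3) * m) * (((m + (n - m) * (16 / 81)) / n) ^ (2 * r)) ^ m *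
        (((m * (16 / 81) + (n - m)) / n) ^ (2 * r)) ^ (n - m))
    else 0
  have hsub : (N.filter fun Γ => ¬ IsRobust (graph Γ) r) ⊆
      (N.filter fun Γ => n ≤ 48 * mutualCount Γ) ∪ Finset.univ.biUnion F := by
    intro Γ hΓ
    rw [Finset.mem_filter] at hΓ
    rw [Finset.mem_union, Finset.mem_filter, Finset.mem_biUnion]
    by_cases hM : n ≤ 48 * mutualCount Γ
    · exact Or.inl ⟨hΓ.1, hM⟩
    · obtain ⟨S, h1, h2, h3⟩ := exists_not_isReachable_of_not_isRobust hΓ.2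
      refine Or.inr ⟨S, Finset.mem_univ _, ?_⟩
      simp only [F, h1, h2, and_self, if_true]
      split_ifs with h12
      · exact Finset.mem_filter.2 ⟨hΓ.1, h3⟩
      · exact Finset.mem_filter.2 ⟨hΓ.1, h3, by omega⟩
  have hF : ∀ S, ((F S).card : ℝ) ≤ C * g S.card * N.card := by
    intro S
    simp only [F, g]
    split_ifs with h1 h2
    · exact card_filter_not_isReachable_small hr hn S h1.1
    · exact card_filter_not_isReachable_large hr hn S
    · simp
  have hg : ∀ m, (n.choose m : ℝ) * g m ≤
      11 / n * (m * (11 / 12) ^ (m - 1)) + (49 / 50 : ℝ) ^ n := by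
    intro m
    have hx : (0 : ℝ) ≤ 11 / n * (m * (11 / 12) ^ (m - 1)) := by positivity
    have hy : (0 : ℝ) ≤ (49 / 50 : ℝ) ^ n := by positivity
    simp only [g]
    split_ifs with h1 h2
    · linarith [choose_mul_small_le hr h1.1 h2]
    · linarith [choose_mul_large_le hr hn0 (not_lt.1 h2) h1.2]
    · linarith
  have hsum : ∑ S : Finset (Fin n), g S.card ≤
      11 / n * ∑' m : ℕ, (m * (11 / 12 : ℝ) ^ (m - 1)) + (n + 1) * (49 / 50 : ℝ) ^ n := by
    have h := Finset.sum_powerset_apply_card g (x := (Finset.univ : Finset (Fin n)))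
    rw [Finset.powerset_univ, Finset.card_univ, Fintype.card_fin] at h
    rw [h]
    calc _ ≤ ∑ m ∈ Finset.range (n + 1),
          (11 / n * (m * (11 / 12) ^ (m - 1)) + (49 / 50 : ℝ) ^ n) :=
          Finset.sum_le_sum fun m _ => by rw [nsmul_eq_mul]; exact hg m
      _ = 11 / n * ∑ m ∈ Finset.range (n + 1), (m * (11 / 12 : ℝ) ^ (m - 1)) +
          (n + 1) * (49 / 50 : ℝ) ^ n := by
          rw [Finset.sum_add_distrib, ← Finset.mul_sum]
          simp
      _ ≤ _ := by
          gcongr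
          exact summable_mul_geometric.sum_le_tsum _ fun m _ => by positivity
  calc (((N.filter fun Γ => ¬ IsRobust (graph Γ) r)).card : ℝ)
      ≤ (N.filter fun Γ => n ≤ 48 * mutualCount Γ).card + ∑ S, ((F S).card : ℝ) := by
        have h := (Finset.card_le_card hsub).trans ((Finset.card_union_le _ _).trans
          (Nat.add_le_add_left Finset.card_biUnion_le _))
        exact_mod_cast h
    _ ≤ 48 * (C * 4 ^ (2 * r)) / n * N.card + ∑ S : Finset (Fin n), C * g S.card * N.card :=
        add_le_add (card_filter_mutualCount_le hn hn0) (Finset.sum_le_sum fun S _ => hF S)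
    _ = C * (48 * 4 ^ (2 * r) / n + ∑ S : Finset (Fin n), g S.card) * N.card := by
        rw [← Finset.sum_mul, ← Finset.mul_sum]; ring
    _ ≤ _ := by
        rw [failureBound, ← hC]
        gcongr

/-- Passing from `K` to `2r` by monotonicity makes the bound independent of `K`; the factor `exp (2
* K ^ 2)` would be useless for growing `K`. -/
lemma one_sub_failureBound_le_probRobust {n K r : ℕ} (hr : 1 ≤ r) (hK : 2 * r ≤ K) (hKn : K < n)
    (hn : 2 * (2 * r) ≤ n) : 1 - ENNReal.ofReal (failureBound r n) ≤ probRobust n K r := by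
  classical
  have := isProbabilityMeasure_selectionLaw hKn
  have hcompl : selectionLaw n K {Γ | ¬ IsRobust (graph Γ) r} ≤
      ENNReal.ofReal (failureBound r n) := by
    rw [selectionLaw_apply hKn]
    refine ENNReal.ofReal_le_ofReal ?_
    have hp : (0 : ℝ) < (selectionFamilies n (2 * r)).card := by
      exact_mod_cast card_selectionFamilies_pos (by omega)
    have hp' : (0 : ℝ) < (selectionFamilies n K).card := by
      exact_mod_cast card_selectionFamilies_pos hKn
    have h1 := card_filter_mul_card_le (n := n) hK (fun Γ => ¬ IsRobust (graph Γ) r)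
      fun Γ Γ' h hb hg => hb (hg.mono (graph_mono h))
    have h1' := (Nat.cast_le (α := ℝ)).2 h1
    push_cast at h1'
    have h2 := card_filter_not_isRobust_le hr hn
    simp only [Set.mem_ofPred_eq]
    rw [div_le_iff₀ hp']
    refine le_of_mul_le_mul_right ?_ hp
    calc _ ≤ _ := h1'
      _ ≤ _ := mul_le_mul_of_nonneg_right h2 hp'.le
      _ = _ := by ring
  rw [tsub_le_iff_right, probRobust]
  calc (1 : ENNReal) = selectionLaw n K Set.univ := measure_univ.symm
    _ ≤ selectionLaw n K ({Γ | IsRobust (graph Γ) r} ∪ {Γ | ¬ IsRobust (graph Γ) r}) :=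
        measure_mono fun Γ _ => em _
    _ ≤ _ := (measure_union_le _ _).trans (add_le_add le_rfl hcompl)

lemma tendsto_probRobust {r : ℕ} (hr : 1 ≤ r) (K : ℕ → ℕ)
    (hK : ∀ᶠ n in atTop, 2 * r ≤ K n ∧ K n < n) :
    Tendsto (fun n => probRobust n (K n) r) atTop (𝓝 1) := by
  have hlim : Tendsto (fun n => 1 - ENNReal.ofReal (failureBound r n)) atTop (𝓝 1) := by
    have h := ENNReal.tendsto_ofReal (tendsto_failureBound r)
    simpa using ENNReal.Tendsto.sub tendsto_const_nhds h (Or.inl ENNReal.one_ne_top)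
  refine tendsto_of_tendsto_of_tendsto_of_le_of_le' hlim tendsto_const_nhds ?_ ?_
  · filter_upwards [hK, eventually_ge_atTop (2 * (2 * r))] with n h hn
    exact one_sub_failureBound_le_probRobust hr h.1 h.2 hn
  · filter_upwards [hK] with n h
    have := isProbabilityMeasure_selectionLaw h.2
    exact prob_le_one

/-! ### Boundedness of the levels and the maximum -/

/-- In a robust graph at most one node has small degree, so the number of edges bounds the
robustness. -/
lemma not_isRobust_graph {n K r : ℕ} (hr : 2 * K < r) (hn : 2 * K + 1 < n)
    {Γ : Fin n → Finset (Fin n)} (hΓ : Γ ∈ selectionFamilies n K) : ¬ IsRobust (graph Γ) r := by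
  classical
  intro hrob
  rw [mem_selectionFamilies] at hΓ
  -- An upper bound for the degree, with mutual neighbours counted twice so that the total is
  -- exactly `2 * K * n`.
  let d : Fin n → ℕ := fun i => (Γ i).card + (Finset.univ.filter fun j => i ∈ Γ j).card
  have hd : ∀ i, IsReachable (graph Γ) r {i} → r ≤ d i := by
    rintro i ⟨j, rfl, hj⟩
    refine hj.trans ((le_trans ?_ (Finset.card_union_le _ _)))
    rw [← Set.ncard_coe_finset]
    refine Set.ncard_le_ncard (fun k hk => ?_) (Set.toFinite _)
    have := (graph_adj.1 hk.1).2
    simpa using this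
  have hsum : ∑ i, d i = 2 * K * n := by
    have h1 : ∑ i, (Finset.univ.filter fun j => i ∈ Γ j).card = ∑ j, (Γ j).card := by
      have := Finset.sum_card_bipartiteAbove_eq_sum_card_bipartiteBelow
        (s := (Finset.univ : Finset (Fin n))) (t := Finset.univ) (fun i j => i ∈ Γ j)
      rw [show (∑ i, (Finset.univ.filter fun j => i ∈ Γ j).card) = _ from this]
      refine Finset.sum_congr rfl fun j _ => ?_
      congr 1
      ext i
      simp [Finset.mem_bipartiteBelow]
    simp only [d]
    rw [Finset.sum_add_distrib, h1]
    simp [(hΓ _).2]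
    ring
  obtain ⟨i, hi⟩ : ∃ i, ∀ j, j ≠ i → r ≤ d j := by
    by_cases h : ∀ j, r ≤ d j
    · exact ⟨⟨0, by omega⟩, fun j _ => h j⟩
    · push Not at h
      obtain ⟨i, hi⟩ := h
      refine ⟨i, fun j hj => ?_⟩
      rcases hrob {i} {j} (Set.singleton_nonempty _) (Set.singleton_nonempty _)
        (by simpa using hj.symm) with h | h
      · exact absurd (hd i h) (not_le.2 hi)
      · exact hd j h
  have h1 : (n - 1) * r ≤ ∑ j ∈ Finset.univ.erase i, d j := by
    have := Finset.card_nsmul_le_sum (Finset.univ.erase i) d r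
      fun j hj => hi j (Finset.ne_of_mem_erase hj)
    simpa using this
  have h2 : ∑ j ∈ Finset.univ.erase i, d j ≤ 2 * K * n :=
    hsum ▸ Finset.sum_le_sum_of_subset (Finset.subset_univ _)
  obtain ⟨l, rfl⟩ : ∃ l, n = l + 1 := ⟨n - 1, by omega⟩
  rw [Nat.add_sub_cancel] at h1
  -- Then `l * (2K + 1) ≤ 2K * (l + 1)`, that is `l ≤ 2K`, against `n = l + 1 > 2K + 1`.
  have h3 : l * (2 * K + 1) ≤ l * r := Nat.mul_le_mul_left _ hr
  nlinarith

lemma le_of_mem_robustLevels {K r : ℕ} (h : r ∈ robustLevels K) : r ≤ 2 * K := by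
  classical
  by_contra hr
  have hzero : (fun n => probRobust n K r) =ᶠ[atTop] fun _ => 0 := by
    filter_upwards [eventually_gt_atTop (2 * K + 1)] with n hn
    rw [probRobust, selectionLaw_apply (by omega), Finset.filter_false_of_mem]
    · simp
    · exact fun Γ hΓ => not_isRobust_graph (not_le.1 hr) hn hΓ
  exact one_ne_zero (tendsto_nhds_unique h.2 (tendsto_const_nhds.congr' hzero.symm))

lemma half_mem_robustLevels {K : ℕ} (hK : 2 ≤ K) : K / 2 ∈ robustLevels K := by
  refine ⟨by omega, tendsto_probRobust (by omega) (fun _ => K) ?_⟩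
  filter_upwards [eventually_gt_atTop K] with n hn
  exact ⟨by omega, hn⟩

end KOut

theorem theorem5 :
    (∀ K : ℕ, 2 ≤ K →
      IsGreatest (KOut.robustLevels K) (KOut.rStar K) ∧ K / 2 ≤ KOut.rStar K) ∧
    (∀ r : ℕ, 1 ≤ r → ∀ K : ℕ → ℕ, (∀ᶠ n in atTop, 2 * r ≤ K n ∧ K n < n) →
      Tendsto (fun n => KOut.probRobust n (K n) r) atTop (𝓝 1)) := by
  refine ⟨fun K hK => ?_, fun r hr K hK => KOut.tendsto_probRobust hr K hK⟩
  -- Without boundedness `sSup` on `ℕ` would take its default value `0`.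
  have hbdd : BddAbove (KOut.robustLevels K) := ⟨2 * K, fun r hr => KOut.le_of_mem_robustLevels hr⟩
  have hmem := KOut.half_mem_robustLevels hK
  exact ⟨⟨Nat.sSup_mem ⟨_, hmem⟩ hbdd, fun r hr => le_csSup hbdd hr⟩, le_csSup hbdd hmem⟩
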